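/- Let $\Sigma,\Delta$ be finite alphabets. A mask is a map $P\colon\Sigma\to\Delta\cup\{\varepsilon\}$, extended to a monoid morphism $P\colon\Sigma^*\to\Delta^*$. Write $\overline L=\{w\in\Sigma^*\mid wu\in L\text{ for some }u\in\Sigma^*\}$ for the prefix closure of $L\subseteq\Sigma^*$; $L$ is prefix-closed if $L=\overline L$. A language $L$ is observable with respect to $\Sigma^*$ and $P$ if for all $s,t\in\overline L$ with $P(s)=P(t)$ and all $a\in\Sigma$, $sa\in\overline L$ implies $ta\in\overline L$. For $K\subseteq\Sigma^*$ let $\overline{\inf}\,\mathrm{O}(K,\Sigma^*,P)$ be the infimal (least) prefix-closed and observable superlanguage of $K$ with respect to $\Sigma^*$ and $P$. The state complexity $\mathrm{sc}(L)$ of a regular language $L$ is the number of states of a minimal deterministic finite automaton marking $L$, where automata may be incomplete (partial transition function, at most one initial state) and have a nonempty set of states. For $n\ge 1$ let $f(n)$ be the worst-case state complexity, that is, the maximum of $\mathrm{sc}(\overline{\inf}\,\mathrm{O}(K,\Sigma^*,P))$ over all finite alphabets $\Sigma,\Delta$, all masks $P\colon\Sigma\to\Delta\cup\{\varepsilon\}$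 and all regular languages $K\subseteq\Sigma^*$ with $\mathrm{sc}(K)=n$. Then $f(n)$ is well defined (the maximum exists) and $$f(n)=\Theta(2^n)\qquad(n\to\infty).$$ More precisely: 1. for all finite alphabets $\Sigma,\Delta$, every mask $P$ and every regular $K\subseteq\Sigma^*$ with $\mathrm{sc}(K)=n$, the language $\overline{\inf}\,\mathrm{O}(K,\Sigma^*,P)$ is regular and has state complexity at most $2^n+1$; 2. for the natural projection $P\colon\{a,b,c\}^*\to\{a,b\}^*$ (which erases $c$ and fixes $a$ and $b$) and every $n\ge 2$, there is a regular language $K_n\subseteq\{a,b,c\}^*$ with $\mathrm{sc}(K_n)=n$ such that $\overline{\inf}\,\mathrm{O}(K_n,\{a,b,c\}^*,P)$ has state complexity at least $\frac34\cdot 2^n-1$. -/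

import Mathlib

open Filter Asymptotics

namespace InfObs

variable {A B : Type*}

/-- The prefix closure of a language. -/
def prefixClosure (L : Language A) : Language A := {w | ∃ u : List A, w ++ u ∈ L}

/-- A language is prefix-closed if it equals its prefix closure. -/
def IsPrefixClosed (L : Language A) : Prop := L = prefixClosure L

/-- A mask from `A` to `B`: every event is sent to an event of `B` or erased (`none`). -/
abbrev Mask (A B : Type*) := A → Option B

/-- The extension of a mask to words, as a monoid morphism. -/
def Mask.onWords (P : Mask A B) (w : List A) : List B := w.filterMap P

open Classical in
/-- The natural projection that keeps the events of `D` and erases all the others. -/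
noncomputable def naturalProjection (D : Set A) : Mask A D :=
  fun x => if h : x ∈ D then some ⟨x, h⟩ else none

/-- `L` is observable with respect to the (plant) language `M` and the mask `P`: whenever `s` and
`t` look the same and are prefixes of words of `L`, an event that `L` allows after `s` is allowed
after `t` too, as soon as `M` makes it possible there. -/
def IsObservable (L M : Language A) (P : Mask A B) : Prop :=
  ∀ s t : List A, s ∈ prefixClosure L → t ∈ prefixClosure L → P.onWords s = P.onWords t →
    ∀ a : A, s ++ [a] ∈ prefixClosure L → t ++ [a] ∈ M → t ++ [a] ∈ prefixClosure L

/-- `L` (inside `M`) is a superlanguage of `K` that is prefix-closed and observable with respect to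
`M` and `P`. -/
structure IsObsSuper (K M : Language A) (P : Mask A B) (L : Language A) : Prop where
  super : K ≤ L
  within : L ≤ M
  prefixClosed : IsPrefixClosed L
  observable : IsObservable L M P

/-- The infimal prefix-closed and observable superlanguage of `K` with respect to `M` and `P`:
the intersection of all of them. By `isLeast_infO` it is itself one of them. -/
def infO (K M : Language A) (P : Mask A B) : Language A :=
  {w | ∀ L : Language A, IsObsSuper K M P L → w ∈ L}

theorem isPrefixClosed_iff {L : Language A} :
    IsPrefixClosed L ↔ ∀ w u : List A, w ++ u ∈ L → w ∈ L := by
  constructor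
  · intro h w u hw
    rw [h]
    exact ⟨u, hw⟩
  · intro h
    ext w
    constructor
    · intro hw
      exact ⟨[], by simpa using hw⟩
    · rintro ⟨u, hu⟩
      exact h w u hu

theorem isLeast_infO {K M : Language A} (P : Mask A B) (hKM : K ≤ M) (hM : IsPrefixClosed M) :
    IsLeast {L : Language A | IsObsSuper K M P L} (infO K M P) := by
  have hpc : IsPrefixClosed (infO K M P) :=
    isPrefixClosed_iff.2 fun w u hw L hL => isPrefixClosed_iff.1 hL.prefixClosed w u (hw L hL)
  refine ⟨⟨fun w hw L hL => hL.super hw, fun w hw => ?_, hpc, ?_⟩, fun L hL w hw => hw L hL⟩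
  · refine hw M ⟨hKM, le_rfl, hM, ?_⟩
    intro s t _ _ _ a _ ha
    rwa [← hM]
  · intro s t hs ht hst a hsa hta
    rw [← hpc] at hs ht hsa ⊢
    intro L hL
    have h := hL.observable s t
    rw [← hL.prefixClosed] at h
    exact h (hs L hL) (ht L hL) hst a (hsa L hL) hta

/-- A deterministic automaton with a partial transition function and at most one initial state. -/
structure PDFA (A : Type*) (Q : Type*) where
  step : Q → A → Option Q
  start : Option Q
  accept : Set Q

/-- The state, if any, that is reached from `q` by reading a word. -/
def PDFA.run {Q : Type*} (M : PDFA A Q) : Q → List A → Option Q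
  | q, [] => some q
  | q, a :: w => (M.step q a).bind fun q' => M.run q' w

/-- The language marked by the automaton. -/
def PDFA.marked {Q : Type*} (M : PDFA A Q) : Language A :=
  {w | ∃ q ∈ M.accept, (M.start.bind fun q₀ => M.run q₀ w) = some q}

/-- The state complexity of a regular language: the least number of states of a (possibly
incomplete) deterministic automaton with a finite nonempty set of states that marks it. -/
noncomputable def stateComplexity (L : Language A) : ℕ :=
  sInf {n : ℕ | 0 < n ∧ ∃ M : PDFA A (Fin n), M.marked = L}

/-- The state complexities of the infimal prefix-closed and observable superlanguages (with respect
to the language of all words) of regular languages of state complexity `n`, for all finite alphabets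
and all masks. -/
def infOComplexities (n : ℕ) : Set ℕ :=
  {m | ∃ (A B : Type) (_ : Finite A) (_ : Finite B) (P : Mask A B) (K : Language A),
    K.IsRegular ∧ stateComplexity K = n ∧ m = stateComplexity (infO K ⊤ P)}

/-- The worst-case state complexity of the infimal prefix-closed and observable superlanguage, as
a function of the state complexity of the given language. -/
noncomputable def worstCase (n : ℕ) : ℕ := sSup (infOComplexities n)

end InfObs

/-! With all words as plant, observability forces a letter after `w` only when some look-alike `s`
of `w` has that letter enabled in the prefix closure of `K`; the least superlanguage contains
nothing else (`append_singleton_mem_infO`). Membership is thus governed by the state estimate: the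
set of states of an automaton for `K` reachable by words with the same observation. The estimate
fixes the enabled letters and its own next value, and it is nonempty along words of the language. So
the nonempty subsets serve as states, which gives `2 ^ n - 1`, slightly better than required.

For the lower bound, the witness is an `n`-cycle with one erased edge from `0` to `1` and a letter
that deletes state `2`. Its estimates are exactly the nonempty sets `T` in which `0 ∈ T` forces `1 ∈
T`. Reachability (`reached_of_erasedClosed`) works backwards: undoing a rotation allows one extra
state, so every target traces back to the full set. Two distinct estimates are separated by rotating
a state of their difference to `0`, where the erased letter tests for it
(`estimate_subset_of_forall`). There are `2 ^ (n - 1) + 2 ^ (n - 2) - 1` such sets. -/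

namespace InfObs

/-! ### Partial automata and state complexity -/

section Automata

variable {A B Q : Type*}

theorem PDFA.run_append (M : PDFA A Q) (q : Q) (u v : List A) :
    M.run q (u ++ v) = (M.run q u).bind fun r => M.run r v := by
  induction u generalizing q with
  | nil => rfl
  | cons a u ih =>
    simp only [List.cons_append, PDFA.run, Option.bind_assoc]
    exact congrArg _ (funext ih)

/-- The state, if any, that is reached from the initial state by reading a word. -/
def PDFA.read (M : PDFA A Q) (w : List A) : Option Q := M.start.bind fun q => M.run q w

@[simp] theorem PDFA.read_nil (M : PDFA A Q) : M.read [] = M.start := by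
  simp [PDFA.read, PDFA.run]

theorem PDFA.read_append (M : PDFA A Q) (u v : List A) :
    M.read (u ++ v) = (M.read u).bind fun r => M.run r v := by
  simp [PDFA.read, PDFA.run_append, Option.bind_assoc]

theorem PDFA.read_append_singleton (M : PDFA A Q) (u : List A) (a : A) :
    M.read (u ++ [a]) = (M.read u).bind fun r => M.step r a := by
  simp [PDFA.read_append, PDFA.run]

theorem PDFA.mem_marked {M : PDFA A Q} {w : List A} :
    w ∈ M.marked ↔ ∃ q ∈ M.accept, M.read w = some q := Iff.rfl

theorem PDFA.mem_prefixClosure_marked {M : PDFA A Q} {w : List A} :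
    w ∈ prefixClosure M.marked ↔
      ∃ q, M.read w = some q ∧ ∃ u, ∃ r ∈ M.accept, M.run q u = some r := by
  constructor
  · rintro ⟨u, r, hr, h⟩
    change M.read (w ++ u) = _ at h
    rw [PDFA.read_append, Option.bind_eq_some_iff] at h
    obtain ⟨q, hq, h⟩ := h
    exact ⟨q, hq, u, r, hr, h⟩
  · rintro ⟨q, hq, u, r, hr, h⟩
    refine ⟨u, r, hr, ?_⟩
    change M.read (w ++ u) = _
    rw [PDFA.read_append, hq, Option.bind_some, h]

/-- The automaton with its states renamed along an equivalence. -/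
def PDFA.rename {R : Type*} (M : PDFA A Q) (e : Q ≃ R) : PDFA A R where
  step r a := (M.step (e.symm r) a).map e
  start := M.start.map e
  accept := e.symm ⁻¹' M.accept

theorem PDFA.read_rename {R : Type*} (M : PDFA A Q) (e : Q ≃ R) (w : List A) :
    (M.rename e).read w = (M.read w).map e := by
  induction w using List.reverseRecOn with
  | nil => simp [PDFA.rename]
  | append_singleton w a ih =>
    rw [PDFA.read_append_singleton, PDFA.read_append_singleton, ih]
    cases M.read w <;> simp [PDFA.rename]

theorem PDFA.marked_rename {R : Type*} (M : PDFA A Q) (e : Q ≃ R) :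
    (M.rename e).marked = M.marked := by
  ext w
  rw [PDFA.mem_marked, PDFA.mem_marked]
  simp only [PDFA.read_rename, Option.map_eq_some_iff]
  constructor
  · rintro ⟨r, hr, q, hq, rfl⟩
    exact ⟨q, by simpa [PDFA.rename] using hr, hq⟩
  · rintro ⟨q, hq, h⟩
    exact ⟨e q, by simpa [PDFA.rename] using hq, q, h, rfl⟩

theorem stateComplexity_marked_le [Fintype Q] [Nonempty Q] (M : PDFA A Q) :
    stateComplexity M.marked ≤ Fintype.card Q :=
  Nat.sInf_le ⟨Fintype.card_pos, M.rename (Fintype.equivFin Q), M.marked_rename _⟩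

theorem PDFA.isRegular_marked [Fintype Q] (M : PDFA A Q) : M.marked.IsRegular := by
  suffices h : ∀ {n : ℕ} (N : PDFA A (Fin n)), N.marked.IsRegular by
    rw [← M.marked_rename (Fintype.equivFin Q)]
    exact h _
  intro n N
  -- `none` is a rejecting sink that makes the transition function total.
  let D : DFA A (Option (Fin n)) :=
    { step := fun o a => o.bind fun q => N.step q a
      start := N.start
      accept := {o | ∃ q ∈ N.accept, o = some q} }
  have hD : ∀ w, D.eval w = N.read w := by
    intro w
    induction w using List.reverseRecOn with
    | nil => simp [D]
    | append_singleton w a ih =>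
      rw [DFA.eval_append_singleton, ih, PDFA.read_append_singleton]
  refine ⟨_, inferInstance, D, ?_⟩
  ext w
  rw [DFA.mem_accepts, hD, PDFA.mem_marked]
  rfl

theorem stateComplexity_spec {L : Language A} (hL : L.IsRegular) :
    0 < stateComplexity L ∧ ∃ M : PDFA A (Fin (stateComplexity L)), M.marked = L := by
  obtain ⟨σ, _, D, rfl⟩ := hL
  let M : PDFA A σ :=
    { step := fun q a => some (D.step q a)
      start := some D.start
      accept := D.accept }
  have hM : ∀ w, M.read w = some (D.eval w) := by
    intro w
    induction w using List.reverseRecOn with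
    | nil => simp [M]
    | append_singleton w a ih =>
      rw [PDFA.read_append_singleton, ih, DFA.eval_append_singleton]
      rfl
  have hmark : M.marked = D.accepts := by
    ext w
    rw [PDFA.mem_marked, DFA.mem_accepts]
    simp [hM, M]
  have : Nonempty σ := ⟨D.start⟩
  exact Nat.sInf_mem (s := {n : ℕ | 0 < n ∧ ∃ M : PDFA A (Fin n), M.marked = D.accepts})
    ⟨Fintype.card σ, Fintype.card_pos, M.rename (Fintype.equivFin σ),
      (M.marked_rename _).trans hmark⟩

/-- Words with pairwise different nonempty left quotients lead to different states. -/
theorem card_le_stateComplexity {ι : Type*} [Fintype ι] {L : Language A} (hL : L.IsRegular)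
    (w : ι → List A) (hw : ∀ i, ∃ u, w i ++ u ∈ L)
    (hne : ∀ i j, (∀ u, w i ++ u ∈ L ↔ w j ++ u ∈ L) → i = j) :
    Fintype.card ι ≤ stateComplexity L := by
  obtain ⟨-, M, hM⟩ := stateComplexity_spec hL
  have h : ∀ i, ∃ q, M.read (w i) = some q := by
    intro i
    have hi : w i ∈ prefixClosure L := hw i
    rw [← hM, PDFA.mem_prefixClosure_marked] at hi
    exact ⟨_, hi.choose_spec.1⟩
  choose q hq using h
  have hinj : Function.Injective q := by
    intro i j hij
    refine hne i j fun u => ?_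
    rw [← hM, PDFA.mem_marked, PDFA.mem_marked, PDFA.read_append, PDFA.read_append, hq, hq, hij]
  simpa using Fintype.card_le_of_injective q hinj

/-- A prefix-closed language is marked by an automaton on `X` as soon as some map to `X` determines
which letters may follow a word and its own value after them. -/
theorem exists_marked_eq {X : Type*} {L : Language A} (hL : ∀ w a, w ++ [a] ∈ L → w ∈ L)
    (f : List A → X)
    (hf : ∀ v ∈ L, ∀ w ∈ L, f v = f w → ∀ a, v ++ [a] ∈ L →
      w ++ [a] ∈ L ∧ f (v ++ [a]) = f (w ++ [a])) :
    ∃ M : PDFA A X, M.marked = L := by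
  classical
  -- A transition is computed from any representative word with the given value; `hf` makes the
  -- choice irrelevant.
  let M : PDFA A X :=
    { step := fun x a =>
        if h : ∃ v, v ∈ L ∧ f v = x ∧ v ++ [a] ∈ L then some (f (h.choose ++ [a])) else none
      start := if [] ∈ L then some (f []) else none
      accept := Set.univ }
  have hM : ∀ w, M.read w = if w ∈ L then some (f w) else none := by
    intro w
    induction w using List.reverseRecOn with
    | nil => simp [M]
    | append_singleton w a ih =>
      rw [PDFA.read_append_singleton, ih]
      by_cases hw : w ∈ L
      · rw [if_pos hw, Option.bind_some]
        by_cases hwa : w ++ [a] ∈ L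
        · have h : ∃ v, v ∈ L ∧ f v = f w ∧ v ++ [a] ∈ L := ⟨w, hw, rfl, hwa⟩
          obtain ⟨h1, h2, h3⟩ := h.choose_spec
          simp only [M]
          rw [dif_pos h, if_pos hwa, (hf _ h1 _ hw h2 a h3).2]
        · have h : ¬ ∃ v, v ∈ L ∧ f v = f w ∧ v ++ [a] ∈ L := by
            rintro ⟨v, h1, h2, h3⟩
            exact hwa (hf v h1 w hw h2 a h3).1
          simp only [M]
          rw [dif_neg h, if_neg hwa]
      · rw [if_neg hw, if_neg fun h => hw (hL w a h), Option.bind_none]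
  refine ⟨M, ?_⟩
  ext w
  rw [PDFA.mem_marked]
  simp [hM, M]

end Automata

/-! ### The infimal superlanguage and the upper bound -/

section Infimal

variable {A B Q : Type*}

theorem Mask.onWords_append (P : Mask A B) (u v : List A) :
    P.onWords (u ++ v) = P.onWords u ++ P.onWords v := List.filterMap_append

theorem nil_mem_infO {K : Language A} {P : Mask A B} : [] ∈ infO K ⊤ P ↔ ∃ w, w ∈ K := by
  constructor
  · intro h
    by_contra! hK
    exact h ⊥ ⟨fun w hw => (hK w hw).elim, bot_le,
      isPrefixClosed_iff.2 fun _ _ h => h.elim, fun s _ hs => hs.choose_spec.elim⟩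
  · rintro ⟨w, hw⟩ L hL
    exact isPrefixClosed_iff.1 hL.prefixClosed [] w (hL.super hw)

/-- By minimality, a letter occurs only if observability forces it. A chain of forced letters is not
needed: every justification can be traced to a single word of the prefix closure of `K`. -/
theorem append_singleton_mem_infO {K : Language A} {P : Mask A B} {w : List A} {a : A} :
    w ++ [a] ∈ infO K ⊤ P ↔
      w ∈ infO K ⊤ P ∧ ∃ s, P.onWords s = P.onWords w ∧ s ++ [a] ∈ prefixClosure K := by
  have hmain : IsObsSuper K ⊤ P (infO K ⊤ P) :=
    (isLeast_infO P le_top (isPrefixClosed_iff.2 fun _ _ _ => trivial)).1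
  have hpc := isPrefixClosed_iff.1 hmain.prefixClosed
  constructor
  · intro h
    refine ⟨hpc w [a] h, ?_⟩
    -- The words all of whose letters are justified directly by `K`. They already form an observable
    -- superlanguage, because justifications transfer between look-alikes, so `N` is everything.
    let N : Language A := {w | w ∈ infO K ⊤ P ∧
      ∀ v b, v ++ [b] <+: w → ∃ s, P.onWords s = P.onWords v ∧ s ++ [b] ∈ prefixClosure K}
    have hNpc : IsPrefixClosed N := isPrefixClosed_iff.2 fun w u hw =>
      ⟨hpc w u hw.1, fun v b hv => hw.2 v b (hv.trans (List.prefix_append w u))⟩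
    have hN : IsObsSuper K ⊤ P N := by
      refine ⟨fun w hw => ⟨hmain.super hw, ?_⟩, le_top, hNpc, ?_⟩
      · rintro v b ⟨u, hu⟩
        exact ⟨v, rfl, u, by rwa [hu]⟩
      · intro s t hs ht hst b hsb _
        rw [← hNpc] at hs ht hsb ⊢
        refine ⟨?_, ?_⟩
        · have := hmain.observable s t
          rw [← hmain.prefixClosed] at this
          exact this hs.1 ht.1 hst b hsb.1 trivial
        · intro v d hv
          rw [List.prefix_concat_iff] at hv
          rcases hv with hv | hv
          · obtain ⟨rfl, hd⟩ := List.append_inj' hv rfl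
            obtain rfl : d = b := by simpa using hd
            obtain ⟨r, hr, hrd⟩ := hsb.2 s d List.prefix_rfl
            exact ⟨r, hr.trans hst, hrd⟩
          · exact ht.2 v d hv
    exact (h N hN).2 w a List.prefix_rfl
  · rintro ⟨hw, s, hs, hsa⟩
    have hle : ∀ v, v ∈ prefixClosure K → v ∈ infO K ⊤ P := fun v ⟨u, hu⟩ =>
      hpc v u (hmain.super hu)
    have := hmain.observable s w
    rw [← hmain.prefixClosed] at this
    exact this (hpc s [a] (hle _ hsa)) hw hs a (hle _ hsa) trivial

/-- The states that a word with the same observation as `v` may lead to. -/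
def PDFA.estimate (M : PDFA A Q) (P : Mask A B) (v : List A) : Set Q :=
  {q | ∃ s, P.onWords s = P.onWords v ∧ M.read s = some q}

theorem PDFA.append_singleton_mem_infO {M : PDFA A Q} {P : Mask A B} {w : List A} {a : A} :
    w ++ [a] ∈ infO M.marked ⊤ P ↔ w ∈ infO M.marked ⊤ P ∧
      ∃ q ∈ M.estimate P w, ∃ u, ∃ r ∈ M.accept, M.run q (a :: u) = some r := by
  rw [InfObs.append_singleton_mem_infO]
  refine and_congr_right fun _ => ?_
  constructor
  · rintro ⟨s, hs, u, r, hr, h⟩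
    change M.read (s ++ [a] ++ u) = _ at h
    rw [List.append_assoc, PDFA.read_append, Option.bind_eq_some_iff] at h
    obtain ⟨q, hq, h⟩ := h
    exact ⟨q, ⟨s, hs, hq⟩, u, r, hr, h⟩
  · rintro ⟨q, ⟨s, hs, hq⟩, u, r, hr, h⟩
    refine ⟨s, hs, u, r, hr, ?_⟩
    change M.read (s ++ [a] ++ u) = _
    rw [List.append_assoc, PDFA.read_append, hq]
    exact h

/-- The word that justifies the last letter is itself readable by `M`. This excludes the empty set
as a state in the upper bound. -/
theorem PDFA.estimate_nonempty {M : PDFA A Q} {P : Mask A B} {w : List A}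
    (hw : w ∈ infO M.marked ⊤ P) : (M.estimate P w).Nonempty := by
  have key : ∀ s, s ∈ prefixClosure M.marked → P.onWords s = P.onWords w →
      (M.estimate P w).Nonempty := by
    intro s hs h
    obtain ⟨q, hq, -⟩ := PDFA.mem_prefixClosure_marked.1 hs
    exact ⟨q, s, h, hq⟩
  induction w using List.reverseRecOn with
  | nil =>
    obtain ⟨u, hu⟩ := nil_mem_infO.1 hw
    exact key [] ⟨u, hu⟩ rfl
  | append_singleton w a _ =>
    obtain ⟨-, s, hs, hsa⟩ := InfObs.append_singleton_mem_infO.1 hw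
    exact key _ hsa (by rw [Mask.onWords_append, Mask.onWords_append, hs])

theorem PDFA.estimate_append_of_none {M : PDFA A Q} {P : Mask A B} {v : List A} {a : A}
    (ha : P a = none) : M.estimate P (v ++ [a]) = M.estimate P v := by
  simp [PDFA.estimate, Mask.onWords, ha]

/-- Splitting a look-alike at its last observed letter shows that the new estimate depends only on
the old one and on `b`. -/
theorem PDFA.mem_estimate_append_of_some {M : PDFA A Q} {P : Mask A B} {v : List A} {a : A}
    {b : B} (ha : P a = some b) {q : Q} :
    q ∈ M.estimate P (v ++ [a]) ↔ ∃ p ∈ M.estimate P v, ∃ x, P x = some b ∧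
      ∃ u, P.onWords u = [] ∧ M.run p (x :: u) = some q := by
  constructor
  · rintro ⟨s, hs, hq⟩
    have hs' : s.filterMap P = v.filterMap P ++ [b] := by
      simpa [Mask.onWords, ha] using hs
    obtain ⟨s₁, s₂, rfl, h₁, h₂⟩ := List.filterMap_eq_append_iff.1 hs'
    obtain ⟨t, x, u, rfl, ht, hx, hu⟩ := List.filterMap_eq_cons_iff.1 h₂
    rw [← List.append_assoc, PDFA.read_append, Option.bind_eq_some_iff] at hq
    obtain ⟨p, hp, hq⟩ := hq
    refine ⟨p, ⟨s₁ ++ t, ?_, hp⟩, x, hx, u, hu, hq⟩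
    have ht' : t.filterMap P = [] := List.filterMap_eq_nil_iff.2 ht
    rw [Mask.onWords, List.filterMap_append, h₁, ht', List.append_nil, Mask.onWords]
  · rintro ⟨p, ⟨s, hs, hp⟩, x, hx, u, hu, hq⟩
    refine ⟨s ++ x :: u, ?_, ?_⟩
    · have hu' : u.filterMap P = [] := hu
      rw [Mask.onWords_append, Mask.onWords_append, hs]
      simp [Mask.onWords, hx, ha, hu']
    · rw [PDFA.read_append, hp]
      exact hq

theorem isRegular_infO_and_stateComplexity_le (P : Mask A B) {K : Language A}
    (hK : K.IsRegular) :
    (infO K ⊤ P).IsRegular ∧ stateComplexity (infO K ⊤ P) ≤ 2 ^ stateComplexity K - 1 := by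
  classical
  obtain ⟨hpos, M, hM⟩ := stateComplexity_spec hK
  generalize stateComplexity K = m at hpos M hM
  subst hM
  have : Nonempty {S : Finset (Fin m) // S ≠ ∅} :=
    ⟨⟨{⟨0, hpos⟩}, Finset.singleton_ne_empty _⟩⟩
  -- The arbitrary value is taken only outside the language, where it plays no role.
  let f : List A → {S : Finset (Fin m) // S ≠ ∅} := fun v =>
    if h : (M.estimate P v).toFinset ≠ ∅ then ⟨_, h⟩ else Classical.arbitrary _
  have hf : ∀ v ∈ infO M.marked ⊤ P, ((f v : Finset (Fin m)) : Set (Fin m)) = M.estimate P v := by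
    intro v hv
    have h : (M.estimate P v).toFinset ≠ ∅ := by
      rw [Ne, Set.toFinset_eq_empty, ← Ne, ← Set.nonempty_iff_ne_empty]
      exact M.estimate_nonempty hv
    simp only [f]
    rw [dif_pos h, Set.coe_toFinset]
  obtain ⟨N, hN⟩ := exists_marked_eq (L := infO M.marked ⊤ P)
    (fun w a h => (PDFA.append_singleton_mem_infO.1 h).1) f (by
      intro v hv w hw hvw a hva
      have he : M.estimate P v = M.estimate P w := by rw [← hf v hv, ← hf w hw, hvw]
      have hwa : w ++ [a] ∈ infO M.marked ⊤ P := by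
        rw [PDFA.append_singleton_mem_infO] at hva ⊢
        exact ⟨hw, he ▸ hva.2⟩
      refine ⟨hwa, Subtype.ext (Finset.coe_injective ?_)⟩
      rw [hf _ hva, hf _ hwa]
      cases ha : P a with
      | none => rw [PDFA.estimate_append_of_none ha, PDFA.estimate_append_of_none ha, he]
      | some b =>
        ext q
        rw [PDFA.mem_estimate_append_of_some ha, PDFA.mem_estimate_append_of_some ha, he])
  rw [← hN]
  refine ⟨N.isRegular_marked, (stateComplexity_marked_le N).trans_eq ?_⟩
  rw [Fintype.card_subtype_compl, Fintype.card_finset, Fintype.card_fin]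
  simp

end Infimal

/-! ### The witness automaton and its estimates -/

section Witness

/-- The states form a cycle under the letter `0`, the letter `1` fixes all states but `2`, where it
is undefined, and the letter `2`, which the projection erases, leads from `0` to `1`. -/
def witness (n : ℕ) : PDFA (Fin 3) (ZMod n) where
  step q x := if x = 0 then some (q + 1) else
    if x = 1 then if q = 2 then none else some q else
    if q = 0 then some 1 else none
  start := some 0
  accept := Set.univ

/-- The natural projection from three letters onto the first two. -/
noncomputable abbrev proj : Mask (Fin 3) ({0, 1} : Set (Fin 3)) := naturalProjection {0, 1}

theorem proj_eq_none_iff {x : Fin 3} : proj x = none ↔ x = 2 := by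
  fin_cases x <;> simp [proj, naturalProjection]

theorem proj_eq_some_iff {x : Fin 3} {b : ({0, 1} : Set (Fin 3))} :
    proj x = some b ↔ x = b := by
  obtain ⟨b, hb⟩ := b
  by_cases hx : x ∈ ({0, 1} : Set (Fin 3))
  · simp only [proj, naturalProjection, dif_pos hx, Option.some.injEq, Subtype.mk.injEq]
  · simp only [proj, naturalProjection, dif_neg hx]
    simp only [reduceCtorEq, false_iff]
    rintro rfl
    exact hx hb

/-- The sets of states that are closed under the erased transition. -/
def ErasedClosed {n : ℕ} (T : Set (ZMod n)) : Prop := 0 ∈ T → 1 ∈ T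

variable {n : ℕ}

/-- The infimal superlanguage generated by the witness. -/
noncomputable abbrev witnessInf (n : ℕ) : Language (Fin 3) := infO (witness n).marked ⊤ proj

theorem nil_mem_witnessInf : [] ∈ witnessInf n :=
  nil_mem_infO.2 ⟨[], 0, trivial, rfl⟩

theorem append_singleton_mem_witnessInf {v : List (Fin 3)} {a : Fin 3} :
    v ++ [a] ∈ witnessInf n ↔
      v ∈ witnessInf n ∧ ∃ q ∈ (witness n).estimate proj v, ∃ r, (witness n).step q a = some r := by
  rw [PDFA.append_singleton_mem_infO]
  refine and_congr_right fun _ => exists_congr fun q => and_congr_right fun _ => ?_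
  constructor
  · rintro ⟨u, r, -, h⟩
    obtain ⟨s, hs, -⟩ := Option.bind_eq_some_iff.1 h
    exact ⟨s, hs⟩
  · rintro ⟨r, hr⟩
    exact ⟨[], r, trivial, by simp [PDFA.run, hr]⟩

/-- The only erased edge goes from `0` to `1`, and `1 ≠ 0` prevents using it twice. -/
theorem run_witness_of_erased [Fact (1 < n)] {u : List (Fin 3)} (hu : proj.onWords u = [])
    {r q : ZMod n} (h : (witness n).run r u = some q) : q = r ∨ r = 0 ∧ q = 1 := by
  induction u generalizing r with
  | nil => exact Or.inl (Option.some.inj h).symm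
  | cons x u ih =>
    have hx : x = 2 := proj_eq_none_iff.1 (List.filterMap_eq_nil_iff.1 hu x (by simp))
    have hu' : proj.onWords u = [] := by
      rw [Mask.onWords, List.filterMap_eq_nil_iff] at hu ⊢
      exact fun y hy => hu y (by simp [hy])
    subst hx
    obtain ⟨s, hs, h⟩ := Option.bind_eq_some_iff.1 h
    have hs' : r = 0 ∧ 1 = s := by simpa [witness] using hs
    obtain ⟨rfl, rfl⟩ := hs'
    rcases ih hu' h with rfl | ⟨h0, -⟩
    · exact Or.inr ⟨rfl, rfl⟩
    · exact absurd h0 one_ne_zero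

theorem erasedClosed_estimate (v : List (Fin 3)) :
    ErasedClosed ((witness n).estimate proj v) := by
  rintro ⟨s, hs, h⟩
  refine ⟨s ++ [2], ?_, ?_⟩
  · have h2 : proj.onWords [2] = [] := by simp [Mask.onWords, proj_eq_none_iff.2]
    rw [Mask.onWords_append, hs, h2, List.append_nil]
  · rw [PDFA.read_append_singleton, h]
    simp [witness]

theorem estimate_nil [Fact (1 < n)] : (witness n).estimate proj [] = {0, 1} := by
  ext q
  constructor
  · rintro ⟨s, hs, h⟩
    rcases run_witness_of_erased hs (r := 0) h with h | ⟨-, h⟩ <;> simp [h]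
  · have h0 : 0 ∈ (witness n).estimate proj [] := ⟨[], rfl, rfl⟩
    rintro (rfl | rfl)
    · exact h0
    · exact erasedClosed_estimate _ h0

theorem mem_estimate_append {v : List (Fin 3)} {a : Fin 3} (ha : a ≠ 2) {q : ZMod n} :
    q ∈ (witness n).estimate proj (v ++ [a]) ↔ ∃ p ∈ (witness n).estimate proj v,
      ∃ r, (witness n).step p a = some r ∧
        ∃ u, proj.onWords u = [] ∧ (witness n).run r u = some q := by
  obtain ⟨b, hb⟩ := Option.ne_none_iff_exists'.1 (mt proj_eq_none_iff.1 ha)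
  rw [PDFA.mem_estimate_append_of_some hb]
  refine exists_congr fun p => and_congr_right fun _ => ?_
  constructor
  · rintro ⟨x, hx, u, hu, h⟩
    obtain rfl : x = a := (proj_eq_some_iff.1 hx).trans (proj_eq_some_iff.1 hb).symm
    obtain ⟨r, hr, h⟩ := Option.bind_eq_some_iff.1 h
    exact ⟨r, hr, u, hu, h⟩
  · rintro ⟨r, hr, u, hu, h⟩
    exact ⟨a, hb, u, hu, Option.bind_eq_some_iff.2 ⟨r, hr, h⟩⟩

/-- The effect of the letter `0` on the estimate. -/
def shift (T : Set (ZMod n)) : Set (ZMod n) := {q | q - 1 ∈ T ∨ q = 1 ∧ -1 ∈ T}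

theorem estimate_append_zero [Fact (1 < n)] (v : List (Fin 3)) :
    (witness n).estimate proj (v ++ [0]) = shift ((witness n).estimate proj v) := by
  ext q
  constructor
  · rw [mem_estimate_append (by decide)]
    rintro ⟨p, hp, r, hr, u, hu, h⟩
    obtain rfl : p + 1 = r := by simpa [witness] using hr
    rcases run_witness_of_erased hu h with rfl | ⟨h0, rfl⟩
    · exact Or.inl (by simpa using hp)
    · exact Or.inr ⟨rfl, by rwa [← eq_neg_of_add_eq_zero_left h0]⟩
  · have key : ∀ p ∈ (witness n).estimate proj v,
        p + 1 ∈ (witness n).estimate proj (v ++ [0]) := fun p hp =>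
      (mem_estimate_append (by decide)).2 ⟨p, hp, p + 1, by simp [witness], [], rfl, rfl⟩
    rintro (h | ⟨rfl, h⟩)
    · simpa using key _ h
    · exact erasedClosed_estimate _ (by simpa using key _ h)

theorem two_ne_one [Fact (1 < n)] : (2 : ZMod n) ≠ 1 := by
  intro h
  refine one_ne_zero (α := ZMod n) ?_
  linear_combination h

theorem estimate_append_one [Fact (1 < n)] (v : List (Fin 3)) :
    (witness n).estimate proj (v ++ [1]) = (witness n).estimate proj v \ {2} := by
  ext q
  rw [mem_estimate_append (by decide)]
  constructor
  · rintro ⟨p, hp, r, hr, u, hu, h⟩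
    have hr' : p ≠ 2 ∧ p = r := by simpa [witness] using hr
    obtain ⟨hp2, rfl⟩ := hr'
    rcases run_witness_of_erased hu h with rfl | ⟨rfl, rfl⟩
    · exact ⟨hp, hp2⟩
    · exact ⟨erasedClosed_estimate _ hp, two_ne_one.symm⟩
  · rintro ⟨hq, hq2⟩
    exact ⟨q, hq, q, by simpa [witness] using hq2, [], rfl, rfl⟩

/-! ### Reachability of all closed nonempty estimates -/

/-- `T` is the estimate after some word of the infimal superlanguage. -/
def Reached (T : Set (ZMod n)) : Prop :=
  ∃ v ∈ witnessInf n, (witness n).estimate proj v = T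

theorem reached_start [Fact (1 < n)] : Reached ({0, 1} : Set (ZMod n)) :=
  ⟨[], nil_mem_witnessInf, estimate_nil⟩

theorem append_zero_mem {v : List (Fin 3)} (hv : v ∈ witnessInf n) : v ++ [0] ∈ witnessInf n := by
  obtain ⟨q, hq⟩ := PDFA.estimate_nonempty hv
  exact append_singleton_mem_witnessInf.2 ⟨hv, q, hq, q + 1, by simp [witness]⟩

theorem Reached.shift [Fact (1 < n)] {T : Set (ZMod n)} (h : Reached T) : Reached (shift T) := by
  obtain ⟨v, hv, rfl⟩ := h
  exact ⟨v ++ [0], append_zero_mem hv, estimate_append_zero v⟩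

theorem Reached.diff [Fact (1 < n)] {T : Set (ZMod n)} (h : Reached T) (hT : (T \ {2}).Nonempty) :
    Reached (T \ {2}) := by
  obtain ⟨v, hv, rfl⟩ := h
  obtain ⟨q, hq, hq2⟩ := hT
  exact ⟨v ++ [1], append_singleton_mem_witnessInf.2 ⟨hv, q, hq, q, by simpa [witness] using hq2⟩,
    estimate_append_one v⟩

theorem add_mem_iterate_shift {T : Set (ZMod n)} {q : ZMod n} (hq : q ∈ T) (k : ℕ) :
    q + k ∈ shift^[k] T := by
  induction k with
  | zero => simpa using hq
  | succ k ih =>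
    rw [Function.iterate_succ_apply']
    refine Or.inl ?_
    convert ih using 1
    push_cast
    ring

theorem Reached.iterate_shift [Fact (1 < n)] {T : Set (ZMod n)} (h : Reached T) (k : ℕ) :
    Reached (InfObs.shift^[k] T) := by
  induction k with
  | zero => exact h
  | succ k ih =>
    rw [Function.iterate_succ_apply']
    exact ih.shift

theorem Reached.erasedClosed {T : Set (ZMod n)} (h : Reached T) : ErasedClosed T := by
  obtain ⟨v, -, rfl⟩ := h
  exact erasedClosed_estimate v

/-- Rotating by `n - 1` steps moves every state back by one, and the erased edge has supplied `1`,
which refills `0`. Each round therefore lengthens the run `0, -1, ..., -j` by one. -/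
theorem reached_univ [Fact (1 < n)] : Reached (Set.univ : Set (ZMod n)) := by
  have hn : 1 < n := Fact.out
  have : NeZero n := ⟨by omega⟩
  have hcast : ((n - 1 : ℕ) : ZMod n) = -1 := by
    rw [Nat.cast_sub hn.le]
    simp
  have key : ∀ j : ℕ, ∃ T : Set (ZMod n), Reached T ∧ ∀ i ≤ j, -(i : ZMod n) ∈ T := by
    intro j
    induction j with
    | zero =>
      refine ⟨_, reached_start, fun i hi => ?_⟩
      obtain rfl : i = 0 := by omega
      simp
    | succ j ih =>
      obtain ⟨T, hT, h⟩ := ih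
      refine ⟨_, hT.iterate_shift (n - 1), fun i hi => ?_⟩
      rcases i with _ | i
      · have h1 : 1 ∈ T := hT.erasedClosed (by simpa using h 0 (by omega))
        convert add_mem_iterate_shift h1 (n - 1) using 1
        rw [hcast]
        simp
      · convert add_mem_iterate_shift (h i (by omega)) (n - 1) using 1
        rw [hcast]
        push_cast
        ring
  obtain ⟨T, hT, h⟩ := key n
  convert hT
  refine (Set.eq_univ_of_forall fun q => ?_).symm
  have := h (-q).val (ZMod.val_lt _).le
  rwa [ZMod.natCast_zmod_val, neg_neg] at this

/-- From the estimate `pullback T`, the letters `0` and `1` lead to `T`. -/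
def pullback (T : Set (ZMod n)) : Set (ZMod n) := {q | q = 1 ∨ q + 1 ∈ T}

/-- Covers the degenerate case `n = 2`, where the state `1` added by `pullback` is also `-1`. -/
theorem ErasedClosed.one_mem_of_neg_one_eq {T : Set (ZMod n)} (hT : ErasedClosed T)
    (hne : T.Nonempty) (h : (-1 : ZMod n) = 1) : 1 ∈ T := by
  have h2 : n ∣ 2 := by
    rw [← CharP.cast_eq_zero_iff (ZMod n) n 2]
    push_cast
    linear_combination -h
  obtain ⟨q, hq⟩ := hne
  have hq' : q = 0 ∨ q = 1 := by
    rcases (Nat.dvd_prime Nat.prime_two).1 h2 with rfl | rfl <;>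
      clear * - q <;> decide +revert
  rcases hq' with rfl | rfl
  · exact hT hq
  · exact hq

theorem shift_pullback {T : Set (ZMod n)} (hT : ErasedClosed T) (hne : T.Nonempty) :
    shift (pullback T) = insert 2 T := by
  ext q
  constructor
  · rintro ((h | h) | ⟨rfl, h | h⟩)
    · exact Or.inl (by linear_combination h)
    · exact Or.inr (by simpa using h)
    · exact Or.inr (hT.one_mem_of_neg_one_eq hne h)
    · exact Or.inr (hT (by simpa using h))
  · rintro (rfl | h)
    · exact Or.inl (Or.inl (by norm_num))
    · exact Or.inl (Or.inr (by simpa using h))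

/-- The extra state `1` of `pullback T` rotates to `2`, exactly where the letter `1` can delete it
if it is unwanted. -/
theorem Reached.of_pullback [Fact (1 < n)] {T : Set (ZMod n)} (hT : ErasedClosed T)
    (hne : T.Nonempty) (h : Reached (pullback T)) : Reached T := by
  have h' := h.shift
  rw [shift_pullback hT hne] at h'
  by_cases h2 : 2 ∈ T
  · rwa [Set.insert_eq_of_mem h2] at h'
  · have hd : insert 2 T \ {2} = T := Set.insert_sdiff_self_of_notMem h2
    rw [← hd]
    exact h'.diff (hd.symm ▸ hne)

theorem erasedClosed_pullback (T : Set (ZMod n)) : ErasedClosed (pullback T) :=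
  fun _ => Or.inl rfl

theorem Reached.of_iterate_pullback [Fact (1 < n)] (k : ℕ) {T : Set (ZMod n)}
    (hT : ErasedClosed T) (hne : T.Nonempty) (h : Reached (pullback^[k] T)) : Reached T := by
  induction k generalizing T with
  | zero => exact h
  | succ k ih => exact .of_pullback hT hne (ih (erasedClosed_pullback T) ⟨1, Or.inl rfl⟩ h)

theorem sub_mem_iterate_pullback (T : Set (ZMod n)) {i k : ℕ} (hi : i < k) :
    (1 - i : ZMod n) ∈ pullback^[k] T := by
  induction k generalizing i with
  | zero => omega
  | succ k ih =>
    rw [Function.iterate_succ_apply']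
    rcases i with _ | i
    · exact Or.inl (by simp)
    · refine Or.inr ?_
      convert ih (i := i) (by omega) using 1
      push_cast
      ring

/-- Each `pullback` inserts `1` and moves the earlier insertions back by one, so `n` of them fill
the cycle. -/
theorem reached_of_erasedClosed [Fact (1 < n)] {T : Set (ZMod n)} (hT : ErasedClosed T)
    (hne : T.Nonempty) : Reached T := by
  have : NeZero n := ⟨by have : 1 < n := Fact.out; omega⟩
  refine .of_iterate_pullback n hT hne ?_
  convert reached_univ (n := n)
  refine Set.eq_univ_of_forall fun q => ?_
  have := sub_mem_iterate_pullback T (ZMod.val_lt (1 - q))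
  rwa [ZMod.natCast_zmod_val, sub_sub_cancel] at this

/-! ### Separating the estimates and counting them -/

theorem append_two_mem_witnessInf {v : List (Fin 3)} :
    v ++ [2] ∈ witnessInf n ↔ v ∈ witnessInf n ∧ 0 ∈ (witness n).estimate proj v := by
  rw [append_singleton_mem_witnessInf]
  refine and_congr_right fun _ => ?_
  constructor
  · rintro ⟨q, hq, r, hr⟩
    have : q = 0 ∧ 1 = r := by simpa [witness] using hr
    rwa [← this.1]
  · exact fun h => ⟨0, h, 1, by simp [witness]⟩

theorem estimate_append_replicate [Fact (1 < n)] (v : List (Fin 3)) (k : ℕ) :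
    (witness n).estimate proj (v ++ List.replicate k 0) =
      shift^[k] ((witness n).estimate proj v) := by
  induction k with
  | zero => simp
  | succ k ih =>
    rw [List.replicate_succ', ← List.append_assoc, estimate_append_zero, ih,
      Function.iterate_succ_apply']

theorem append_replicate_mem {v : List (Fin 3)} (hv : v ∈ witnessInf n) (k : ℕ) :
    v ++ List.replicate k 0 ∈ witnessInf n := by
  induction k with
  | zero => simpa using hv
  | succ k ih =>
    rw [List.replicate_succ', ← List.append_assoc]
    exact append_zero_mem ih

/-- The erased edge can only add `1`, and a gap that starts above `0` and stops by `n` never moves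
onto `1`. -/
theorem notMem_iterate_shift {T : Set (ZMod n)} {q k : ℕ} (hq : (q : ZMod n) ∉ T)
    (hk : k ≠ 0 → 0 < q ∧ q + k ≤ n) : ((q + k : ℕ) : ZMod n) ∉ shift^[k] T := by
  induction k with
  | zero => simpa using hq
  | succ k ih =>
    obtain ⟨h0, hle⟩ := hk (by omega)
    rw [Function.iterate_succ_apply']
    rintro (h | ⟨h, -⟩)
    · refine ih (fun _ => ⟨h0, by omega⟩) ?_
      convert h using 1
      push_cast
      ring
    · have h' : ((q + k : ℕ) : ZMod n) = 0 := by
        push_cast at h ⊢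
        linear_combination h
      have := Nat.le_of_dvd (by omega) ((CharP.cast_eq_zero_iff (ZMod n) n _).1 h')
      omega

theorem estimate_subset_of_forall [Fact (1 < n)] {v w : List (Fin 3)} (hv : v ∈ witnessInf n)
    (h : ∀ u, v ++ u ∈ witnessInf n → w ++ u ∈ witnessInf n) :
    (witness n).estimate proj v ⊆ (witness n).estimate proj w := by
  have : NeZero n := ⟨by have : 1 < n := Fact.out; omega⟩
  intro q hq
  by_contra hqw
  -- `k` rotations bring `q` to `0`; when `q` is already `0` none may be made, since the gap would
  -- then move onto `1`.
  obtain ⟨k, hk, h0⟩ : ∃ k : ℕ, (k ≠ 0 → 0 < q.val ∧ q.val + k ≤ n) ∧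
      ((q.val + k : ℕ) : ZMod n) = 0 := by
    by_cases hq0 : q = 0
    · exact ⟨0, by simp, by simp [hq0]⟩
    · refine ⟨n - q.val, fun _ => ⟨?_, ?_⟩, ?_⟩
      · exact Nat.pos_of_ne_zero fun h => hq0 ((ZMod.val_eq_zero q).1 h)
      · have := ZMod.val_lt q
        omega
      · rw [Nat.add_sub_cancel' (ZMod.val_lt q).le]
        simp
  have hmem := add_mem_iterate_shift hq k
  have hnot := notMem_iterate_shift (T := (witness n).estimate proj w) (q := q.val) (k := k)
    (by rwa [ZMod.natCast_zmod_val]) hk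
  rw [h0] at hnot
  rw [Nat.cast_add, ZMod.natCast_zmod_val] at h0
  rw [h0] at hmem
  have hvk : v ++ (List.replicate k 0 ++ [2]) ∈ witnessInf n := by
    rw [← List.append_assoc, append_two_mem_witnessInf, estimate_append_replicate]
    exact ⟨append_replicate_mem hv k, hmem⟩
  have hwk := h _ hvk
  rw [← List.append_assoc, append_two_mem_witnessInf, estimate_append_replicate] at hwk
  exact hnot hwk.2

theorem card_erasedClosed_le [Fact (1 < n)] [NeZero n] :
    2 ^ (n - 1) + 2 ^ (n - 2) - 1 ≤ Nat.card {T : Finset (ZMod n) //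
      ErasedClosed (T : Set (ZMod n)) ∧ T.Nonempty} := by
  classical
  -- The closed sets either avoid `0` or contain both `0` and `1`.
  have hdisj : Disjoint ((Finset.univ.erase (0 : ZMod n)).powerset)
      (Finset.Icc {0, 1} (Finset.univ : Finset (ZMod n))) := by
    rw [Finset.disjoint_left]
    intro T hT hT'
    rw [Finset.mem_powerset] at hT
    have := hT ((Finset.mem_Icc.1 hT').1 (by simp : (0 : ZMod n) ∈ ({0, 1} : Finset (ZMod n))))
    simp at this
  have hcard : ((((Finset.univ.erase (0 : ZMod n)).powerset) ∪
      (Finset.Icc {0, 1} (Finset.univ : Finset (ZMod n)))).erase ∅).card =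
      2 ^ (n - 1) + 2 ^ (n - 2) - 1 := by
    rw [Finset.card_erase_of_mem (by simp), Finset.card_union_of_disjoint hdisj,
      Finset.card_powerset, Finset.card_erase_of_mem (by simp),
      Finset.card_Icc_finset (Finset.subset_univ _), Finset.card_pair zero_ne_one,
      Finset.card_univ, ZMod.card]
  rw [Nat.card_eq_fintype_card, Fintype.card_subtype, ← hcard]
  refine Finset.card_le_card fun T hT => ?_
  rw [Finset.mem_erase, Finset.mem_union] at hT
  rw [Finset.mem_filter]
  refine ⟨Finset.mem_univ _, fun h0 => ?_, Finset.nonempty_iff_ne_empty.2 hT.1⟩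
  rcases hT.2 with h | h
  · have := Finset.mem_powerset.1 h h0
    simp at this
  · exact (Finset.mem_Icc.1 h).1 (by simp)

theorem le_stateComplexity_witnessInf [Fact (1 < n)] [NeZero n] :
    2 ^ (n - 1) + 2 ^ (n - 2) - 1 ≤ stateComplexity (witnessInf n) := by
  refine card_erasedClosed_le.trans ?_
  have hreg : (witnessInf n).IsRegular :=
    (isRegular_infO_and_stateComplexity_le proj (witness n).isRegular_marked).1
  have hreach : ∀ T : {T : Finset (ZMod n) // ErasedClosed (T : Set (ZMod n)) ∧ T.Nonempty},
      Reached (T.1 : Set (ZMod n)) := fun T =>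
    reached_of_erasedClosed T.2.1 (Finset.coe_nonempty.2 T.2.2)
  choose w hw hT using hreach
  have := Fintype.ofFinite {T : Finset (ZMod n) // ErasedClosed (T : Set (ZMod n)) ∧ T.Nonempty}
  rw [Nat.card_eq_fintype_card]
  refine card_le_stateComplexity hreg w (fun T => ⟨[], by simpa using hw T⟩) fun T U h => ?_
  refine Subtype.ext (Finset.coe_injective ?_)
  rw [← hT T, ← hT U]
  exact Set.Subset.antisymm (estimate_subset_of_forall (hw T) fun u => (h u).1)
    (estimate_subset_of_forall (hw U) fun u => (h u).2)

/-- Minimality follows from the two bounds: with at most `n - 1` states, the upper bound `2 ^ (n -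
1) - 1` would contradict the lower one. -/
theorem stateComplexity_witness [Fact (1 < n)] [NeZero n] :
    stateComplexity (witness n).marked = n := by
  refine le_antisymm ((stateComplexity_marked_le _).trans_eq (ZMod.card n)) ?_
  have hn : 1 < n := Fact.out
  have h := (le_stateComplexity_witnessInf (n := n)).trans
    (isRegular_infO_and_stateComplexity_le proj (witness n).isRegular_marked).2
  by_contra! hlt
  have h1 : 2 ^ stateComplexity (witness n).marked ≤ 2 ^ (n - 1) :=
    Nat.pow_le_pow_right (by norm_num) (by omega)
  have h2 : 0 < 2 ^ (n - 2) := by positivity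
  have h3 : 0 < 2 ^ stateComplexity (witness n).marked := by positivity
  omega

theorem exists_witness {n : ℕ} (hn : 2 ≤ n) :
    ∃ K : Language (Fin 3), K.IsRegular ∧ stateComplexity K = n ∧
      (3 / 4 : ℝ) * 2 ^ n - 1 ≤ (stateComplexity
        (infO K ⊤ (naturalProjection ({0, 1} : Set (Fin 3)))) : ℝ) := by
  have : Fact (1 < n) := ⟨hn⟩
  have : NeZero n := ⟨by omega⟩
  refine ⟨_, (witness n).isRegular_marked, stateComplexity_witness, ?_⟩
  have h := le_stateComplexity_witnessInf (n := n)
  rw [Nat.sub_le_iff_le_add] at h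
  have h' : (2 : ℝ) ^ (n - 1) + 2 ^ (n - 2) ≤ stateComplexity (witnessInf n) + 1 := by
    exact_mod_cast h
  obtain ⟨m, rfl⟩ := Nat.exists_eq_add_of_le' hn
  rw [show m + 2 - 1 = m + 1 by omega, show m + 2 - 2 = m by omega] at h'
  rw [pow_succ] at h'
  rw [pow_succ, pow_succ]
  linarith

end Witness

/-! ### The worst case and its order of growth -/

section WorstCase

theorem stateComplexity_bot {A : Type*} : stateComplexity (⊥ : Language A) = 1 := by
  have h : (⟨fun _ _ => none, none, ∅⟩ : PDFA A (Fin 1)).marked = ⊥ := by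
    ext w
    rw [PDFA.mem_marked]
    constructor
    · rintro ⟨q, hq, -⟩
      exact hq
    · exact fun h => h.elim
  have hreg : (⊥ : Language A).IsRegular := h ▸ PDFA.isRegular_marked _
  refine le_antisymm ?_ (stateComplexity_spec hreg).1
  have := stateComplexity_marked_le (⟨fun _ _ => none, none, ∅⟩ : PDFA A (Fin 1))
  rwa [h] at this

theorem isRegular_bot {A : Type*} : (⊥ : Language A).IsRegular :=
  ⟨Unit, inferInstance, ⟨fun _ _ => (), (), ∅⟩, by ext w; rfl⟩

theorem le_of_mem_infOComplexities {n m : ℕ} (hm : m ∈ infOComplexities n) : m ≤ 2 ^ n + 1 := by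
  obtain ⟨A, B, _, _, P, K, hK, rfl, rfl⟩ := hm
  have := (isRegular_infO_and_stateComplexity_le P hK).2
  exact (this.trans (Nat.sub_le _ _)).trans (Nat.le_succ _)

theorem infOComplexities_nonempty {n : ℕ} (hn : 1 ≤ n) : (infOComplexities n).Nonempty := by
  rcases hn.eq_or_lt with rfl | hn
  -- The witness needs `n ≥ 2`; for `n = 1` the empty language serves, since an automaton must have
  -- a state.
  · exact ⟨_, Fin 3, Fin 3, inferInstance, inferInstance, some, ⊥, isRegular_bot,
      stateComplexity_bot, rfl⟩
  · obtain ⟨K, hK, hn, -⟩ := exists_witness hn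
    exact ⟨_, Fin 3, _, inferInstance, inferInstance, proj, K, hK, hn, rfl⟩

theorem bddAbove_infOComplexities (n : ℕ) : BddAbove (infOComplexities n) :=
  ⟨2 ^ n + 1, fun _ hm => le_of_mem_infOComplexities hm⟩

theorem isGreatest_worstCase {n : ℕ} (hn : 1 ≤ n) :
    IsGreatest (infOComplexities n) (worstCase n) :=
  ⟨Nat.sSup_mem (infOComplexities_nonempty hn) (bddAbove_infOComplexities n),
    fun _ hm => le_csSup (bddAbove_infOComplexities n) hm⟩

theorem worstCase_isTheta :
    (fun n : ℕ => (worstCase n : ℝ)) =Θ[atTop] (fun n : ℕ => (2 : ℝ) ^ n) := by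
  constructor
  · refine IsBigO.of_bound 2 (eventually_atTop.2 ⟨1, fun n hn => ?_⟩)
    have h : (worstCase n : ℝ) ≤ 2 ^ n + 1 := by
      exact_mod_cast le_of_mem_infOComplexities (isGreatest_worstCase hn).1
    have h1 : (1 : ℝ) ≤ 2 ^ n := one_le_pow₀ (by norm_num)
    rw [Real.norm_of_nonneg (by positivity), Real.norm_of_nonneg (by positivity)]
    linarith
  -- `2 * (3 / 4 * 2 ^ n - 1) ≥ 2 ^ n` holds once `2 ^ n ≥ 4`.
  · refine IsBigO.of_bound 2 (eventually_atTop.2 ⟨2, fun n hn => ?_⟩)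
    obtain ⟨K, hK, hKn, h⟩ := exists_witness hn
    have hle : stateComplexity (infO K ⊤ proj) ≤ worstCase n :=
      (isGreatest_worstCase (by omega)).2
        ⟨Fin 3, _, inferInstance, inferInstance, proj, K, hK, hKn, rfl⟩
    have hle' : (stateComplexity (infO K ⊤ proj) : ℝ) ≤ worstCase n := by exact_mod_cast hle
    have h1 : (2 : ℝ) ^ 2 ≤ 2 ^ n := pow_le_pow_right₀ (by norm_num) hn
    rw [Real.norm_of_nonneg (by positivity), Real.norm_of_nonneg (by positivity)]
    linarith

end WorstCase

end InfObs

theorem mainTheorem3 :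
    -- upper bound, for all finite alphabets, masks and regular languages
    (∀ (A : Type*) (B : Type*) [Finite A] [Finite B] (P : InfObs.Mask A B) (K : Language A),
      K.IsRegular →
        (InfObs.infO K ⊤ P).IsRegular ∧
        InfObs.stateComplexity (InfObs.infO K ⊤ P) ≤ 2 ^ InfObs.stateComplexity K + 1) ∧
    -- lower bound, already for the projection from three letters onto two of them
    (∀ n : ℕ, 2 ≤ n → ∃ K : Language (Fin 3), K.IsRegular ∧ InfObs.stateComplexity K = n ∧
      (3 / 4 : ℝ) * 2 ^ n - 1 ≤
        (InfObs.stateComplexity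
          (InfObs.infO K ⊤ (InfObs.naturalProjection ({0, 1} : Set (Fin 3)))) : ℝ)) ∧
    -- the worst case is attained, and it is of order `2 ^ n`
    (∀ n : ℕ, 1 ≤ n → IsGreatest (InfObs.infOComplexities n) (InfObs.worstCase n)) ∧
    (fun n : ℕ => (InfObs.worstCase n : ℝ)) =Θ[atTop] (fun n : ℕ => (2 : ℝ) ^ n) := by
  refine ⟨fun A B _ _ P K hK => ?_, fun n hn => InfObs.exists_witness hn,
    fun n hn => InfObs.isGreatest_worstCase hn, InfObs.worstCase_isTheta⟩
  obtain ⟨h, hle⟩ := InfObs.isRegular_infO_and_stateComplexity_le P hK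
  exact ⟨h, (hle.trans (Nat.sub_le _ _)).trans (Nat.le_succ _)⟩
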